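/- **Conventions.** A *Bernstein function* is a smooth function $f:(0,\infty)\to[0,\infty)$ with $(-1)^{k-1}f^{(k)}\ge 0$ for all $k\ge 1$, extended to $[0,\infty)$ by $f(0):=f(0+)$. A smooth function $m$ on $(0,\infty)$ is *completely monotone* if $(-1)^k m^{(k)}\ge 0$ for all $k\ge 0$. A Bernstein function $g$ is *complete* if there are $a,b\ge 0$ and a completely monotone $m$ with $\int_0^\infty \min(1,s)\,m(s)\,ds<\infty$ and $$g(u)=a+bu+\int_0^\infty (1-e^{-us})\,m(s)\,ds,\qquad u>0 .$$ A *Lévy process* in $\mathbb R$ is a process $(X_t)_{t\ge 0}$ with $X_0=0$ almost surely, with independent and stationary increments, and continuous in probability. **Theorem.** Let $(X_t)_{t\ge 0}$ be a Lévy process in $\mathbb R$ with $$\mathbb E\,e^{i\xi X_t}=e^{-tf(|\xi|)},\qquad \xi\in\mathbb R,\ t>0,$$ for some Bernstein function $f$ satisfying $f(0)=0$ and $\int_0^\infty e^{-tf(r)}\,dr<\infty$ for all $t>0$. For $t>0$ let $p_t$ denote the transition density of the process, that is, the continuous version of the density of the law of $X_t$ with respect to Lebesgue measure. Then for each $t>0$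 there exists a complete Bernstein function $g_t$ such that $$\frac{p_t(x)}{p_t(0)}=e^{-g_t(|x|^2)}\qquad\text{for all } x\in\mathbb R .$$ -/

import Mathlib

open MeasureTheory ProbabilityTheory Filter Set
open scoped Topology NNReal ContDiff

/-- A completely monotone function on `(0,∞)`: smooth there, with `(-1)^k m^{(k)} ≥ 0` for all
`k ≥ 0`. Values of `m` outside `(0,∞)` play no role. -/
structure IsCompletelyMonotone (m : ℝ → ℝ) : Prop where
  contDiffOn : ContDiffOn ℝ ∞ m (Ioi 0)
  sign : ∀ k : ℕ, ∀ x : ℝ, 0 < x → 0 ≤ (-1) ^ k * iteratedDeriv k m x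

/-- A Bernstein function: smooth and nonnegative on `(0,∞)`, with `(-1)^(k-1) f^{(k)} ≥ 0` there
for all `k ≥ 1`. As usual it is extended to `[0,∞)` by `f(0) = f(0+)`, which is the field
`continuousAt_zero`. Values of `f` on the negative half-line play no role. -/
structure IsBernstein (f : ℝ → ℝ) : Prop where
  continuousAt_zero : Tendsto f (𝓝[>] 0) (𝓝 (f 0))
  contDiffOn : ContDiffOn ℝ ∞ f (Ioi 0)
  nonneg : ∀ x : ℝ, 0 < x → 0 ≤ f x
  sign : ∀ k : ℕ, 1 ≤ k → ∀ x : ℝ, 0 < x → 0 ≤ (-1) ^ (k - 1) * iteratedDeriv k f x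

/-- A complete Bernstein function: a Bernstein function whose Lévy measure has a completely
monotone density `m` with respect to Lebesgue measure on `(0,∞)`, i.e.
`f(x) = a + b x + ∫_(0,∞) (1 - e^{-x s}) m(s) ds` with `a, b ≥ 0` and
`∫_(0,∞) min(1,s) m(s) ds < ∞`. -/
structure IsCompleteBernstein (f : ℝ → ℝ) : Prop where
  isBernstein : IsBernstein f
  exists_density : ∃ (a b : ℝ) (m : ℝ → ℝ), 0 ≤ a ∧ 0 ≤ b ∧ IsCompletelyMonotone m ∧
    IntegrableOn (fun s : ℝ => min 1 s * m s) (Ioi 0) ∧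
    ∀ x : ℝ, 0 < x →
      f x = a + b * x + ∫ s in Ioi (0 : ℝ), (1 - Real.exp (-(x * s))) * m s

/-- A real-valued Lévy process: it starts at `0`, has independent and stationary increments, and
is continuous in probability. -/
structure IsLevyProcess {Ω : Type*} [MeasurableSpace Ω] (X : ℝ≥0 → Ω → ℝ) (P : Measure Ω) :
    Prop where
  measurable : ∀ t, Measurable (X t)
  zero : ∀ᵐ w ∂P, X 0 w = 0
  indep : HasIndepIncrements X P
  stationary : ∀ s t : ℝ≥0, P.map (fun w => X (s + t) w - X s w) = P.map (X t)
  continuous : ∀ t : ℝ≥0, TendstoInMeasure P X (𝓝 t) (X t)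

/-- `p t`, for `t > 0`, is the (continuous version of the) transition density of the Lévy process
`X`, i.e. a continuous probability density of the law of `X t`. -/
structure IsTransitionDensity {Ω : Type*} [MeasurableSpace Ω] (X : ℝ≥0 → Ω → ℝ) (P : Measure Ω)
    (p : ℝ≥0 → ℝ → ℝ) : Prop where
  continuous : ∀ t, 0 < t → Continuous (p t)
  nonneg : ∀ t, 0 < t → ∀ x, 0 ≤ p t x
  map_eq : ∀ t, 0 < t → P.map (X t) = volume.withDensity (fun x => ENNReal.ofReal (p t x))

/-! Fourier inversion gives `p t x = π⁻¹ ∫₀^∞ e^{-t f(r)} cos(xr) dr`. As `f` is Bernstein,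
`e^{-tf}` is completely monotone, morally a mixture of exponentials `e^{-sr}`. The cosine transform
of `e^{-sr}` is `s / (x² + s²)`, so the density is, in the variable `u = x²`, a Stieltjes function
`h`: a limit of sums `∑ c_j / (u + a_j)`. What remains is that `-log (h u / h 0)` is complete
Bernstein.

For a finite sum the zeros `-b_k` interlace the poles `-a_k` (`exists_interlacing_factorization`).
The logarithm is then a sum of terms `log (1 + u/a) - log (1 + u/b) = ∫_a^b u / (x (x + u)) dx` with
`a < b`, plus one unpaired logarithm, hence a mixture of the kernels `u / (u + x)`. Mixtures over
the compactified parameter interval are stable under pointwise limits by weak compactness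
(`mem_cbfCone_of_tendsto`), and Fubini turns a mixture into a Lévy–Khintchine formula with
completely monotone density (`isCompleteBernstein_of_mem_cbfCone`).

Bernstein's representation theorem is bypassed. The Taylor series of a completely monotone function
at `n` (`AltDerivSeq.hasSum_taylor`), evaluated at `n (1 - e^{-r/n}) → r`, is a series in
`e^{-kr/n}` with nonnegative coefficients. -/

/-! ### Taylor series of completely monotone functions -/

/-- A sequence of nonnegative functions on `(0,∞)`, each of which is minus the derivative of the
previous one: `G k = (-1)^k (G 0)^{(k)}`, so `G 0` is completely monotone. -/
structure AltDerivSeq (G : ℕ → ℝ → ℝ) : Prop where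
  nonneg : ∀ k x, 0 < x → 0 ≤ G k x
  hasDerivAt : ∀ k x, 0 < x → HasDerivAt (G k) (-(G (k + 1) x)) x

/-- Taylor remainder of order `K` at `a` of the `j`-th member of an alternating sequence. -/
noncomputable def altRemainder (G : ℕ → ℝ → ℝ) (a : ℝ) (K j : ℕ) (x : ℝ) : ℝ :=
  G j x - ∑ k ∈ Finset.range K, G (j + k) a / (k.factorial : ℝ) * (a - x) ^ k

namespace AltDerivSeq

variable {G : ℕ → ℝ → ℝ}

lemma antitoneOn (hG : AltDerivSeq G) : AntitoneOn (G 0) (Ioi 0) := by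
  apply antitoneOn_of_deriv_nonpos (convex_Ioi 0)
  · exact fun x hx => (hG.hasDerivAt 0 x hx).continuousAt.continuousWithinAt
  · rw [interior_Ioi]
    exact fun x hx => (hG.hasDerivAt 0 x hx).differentiableAt.differentiableWithinAt
  · rw [interior_Ioi]
    intro x hx
    rw [(hG.hasDerivAt 0 x hx).deriv]
    simpa using hG.nonneg 1 x hx

lemma altRemainder_self (a : ℝ) (K j : ℕ) : altRemainder G a (K + 1) j a = 0 := by
  simp [altRemainder, Finset.sum_range_succ']

/-- Differentiation lowers the order and raises the index; the inductions below run on this, since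
remainders of positive order vanish at `a`. -/
lemma hasDerivAt_altRemainder (hG : AltDerivSeq G) (a : ℝ) (K j : ℕ) {x : ℝ} (hx : 0 < x) :
    HasDerivAt (altRemainder G a (K + 1) j) (-(altRemainder G a K (j + 1) x)) x := by
  have h1 : HasDerivAt (fun y => ∑ k ∈ Finset.range (K + 1),
      G (j + k) a / (k.factorial : ℝ) * (a - y) ^ k)
      (∑ k ∈ Finset.range (K + 1), G (j + k) a / (k.factorial : ℝ) *
        (k * (a - x) ^ (k - 1) * (-1))) x := by
    apply HasDerivAt.fun_sum
    intro k _
    exact (((hasDerivAt_id x).const_sub a).pow k).const_mul _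
  refine ((hG.hasDerivAt j x hx).sub h1).congr_deriv ?_
  rw [Finset.sum_range_succ']
  simp only [altRemainder, Nat.cast_zero, zero_mul, mul_zero, add_zero, neg_sub]
  have : ∀ k ∈ Finset.range K, G (j + (k + 1)) a / ((k + 1).factorial : ℝ) *
      (((k + 1 : ℕ) : ℝ) * (a - x) ^ (k + 1 - 1) * -1) =
      -(G (j + 1 + k) a / (k.factorial : ℝ) * (a - x) ^ k) := by
    intro k _
    have h2 : (k.factorial : ℝ) ≠ 0 := by positivity
    have h3 : (k : ℝ) + 1 ≠ 0 := by positivity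
    rw [show j + (k + 1) = j + 1 + k by ring, Nat.factorial_succ]
    push_cast
    field_simp
  rw [Finset.sum_congr rfl this, Finset.sum_neg_distrib]
  ring

lemma nonneg_of_hasDerivAt_nonpos {D D' : ℝ → ℝ} {a : ℝ} (ha : 0 < a)
    (hD : ∀ x, 0 < x → HasDerivAt D (D' x) x) (hD' : ∀ x, 0 < x → x ≤ a → D' x ≤ 0)
    (hDa : 0 ≤ D a) {x : ℝ} (hx : 0 < x) (hxa : x ≤ a) : 0 ≤ D x := by
  have h : AntitoneOn D (Ioc 0 a) := by
    apply antitoneOn_of_deriv_nonpos (convex_Ioc 0 a)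
    · exact fun y hy => (hD y hy.1).continuousAt.continuousWithinAt
    · rw [interior_Ioc]
      exact fun y hy => (hD y hy.1).differentiableAt.differentiableWithinAt
    · rw [interior_Ioc]
      intro y hy
      rw [(hD y hy.1).deriv]
      exact hD' y hy.1 hy.2.le
  exact hDa.trans (h ⟨hx, hxa⟩ ⟨ha, le_rfl⟩ hxa)

lemma altRemainder_nonneg (hG : AltDerivSeq G) {a : ℝ} (ha : 0 < a) (K j : ℕ) {x : ℝ}
    (hx : 0 < x) (hxa : x ≤ a) : 0 ≤ altRemainder G a K j x := by
  induction K generalizing j x with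
  | zero => simpa [altRemainder] using hG.nonneg j x hx
  | succ K ih =>
    exact nonneg_of_hasDerivAt_nonpos ha (fun y hy => hG.hasDerivAt_altRemainder a K j hy)
      (fun y hy hya => by simpa using ih (j + 1) hy hya) (altRemainder_self a K j).ge hx hxa

/-- The derivative of this expression is minus the same expression with `K` lowered and `j` raised,
and it vanishes at `a`. It is the numerator inequality making `altRemainder G a (K + 1) j x / (a -
x) ^ (K + 1)` antitone. -/
lemma altRemainder_succ_le (hG : AltDerivSeq G) {a : ℝ} (ha : 0 < a) (K j : ℕ) {x : ℝ}
    (hx : 0 < x) (hxa : x ≤ a) :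
    0 ≤ (a - x) * altRemainder G a K (j + 1) x - (K + 1) * altRemainder G a (K + 1) j x := by
  induction K generalizing j x with
  | zero =>
    refine nonneg_of_hasDerivAt_nonpos (D := fun x => (a - x) * altRemainder G a 0 (j + 1) x -
      ((0 : ℕ) + 1) * altRemainder G a (0 + 1) j x) (D' := fun x => -((a - x) * G (j + 2) x)) ha
      (fun y hy => ?_) (fun y hy hya => ?_) ?_ hx hxa
    · have h0 : HasDerivAt (altRemainder G a 0 (j + 1)) (-(G (j + 2) y)) y := by
        have : altRemainder G a 0 (j + 1) = G (j + 1) := by ext; simp [altRemainder]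
        rw [this]
        exact hG.hasDerivAt (j + 1) y hy
      refine ((((hasDerivAt_id y).const_sub a).mul h0).sub
        ((hG.hasDerivAt_altRemainder a 0 j hy).const_mul _)).congr_deriv ?_
      simp [altRemainder]
    · have := mul_nonneg (sub_nonneg.2 hya) (hG.nonneg (j + 2) y hy)
      linarith
    · simp [altRemainder_self]
  | succ K ih =>
    refine nonneg_of_hasDerivAt_nonpos (D := fun x => (a - x) * altRemainder G a (K + 1) (j + 1) x -
      ((K + 1 : ℕ) + 1) * altRemainder G a (K + 1 + 1) j x)
      (D' := fun x => -((a - x) * altRemainder G a K (j + 1 + 1) x -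
        (K + 1) * altRemainder G a (K + 1) (j + 1) x)) ha
      (fun y hy => ?_) (fun y hy hya => ?_) ?_ hx hxa
    · refine ((((hasDerivAt_id y).const_sub a).mul
        (hG.hasDerivAt_altRemainder a K (j + 1) hy)).sub
        ((hG.hasDerivAt_altRemainder a (K + 1) j hy).const_mul _)).congr_deriv ?_
      simp only [id]
      push_cast
      ring
    · have := ih (j + 1) hy hya
      linarith
    · simp [altRemainder_self]

/-- The quotient of the remainder by `(a - y) ^ K` is antitone on `(0,a)`. For `z < x` this gives
geometric decay in `K`. -/
lemma altRemainder_mul_pow_le (hG : AltDerivSeq G) {a : ℝ} (K : ℕ) {z x : ℝ}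
    (hz : 0 < z) (hzx : z ≤ x) (hxa : x < a) :
    altRemainder G a K 0 x ≤ ((a - x) / (a - z)) ^ K * altRemainder G a K 0 z := by
  have ha : 0 < a := by linarith
  have h : AntitoneOn (fun y => altRemainder G a K 0 y / (a - y) ^ K) (Ioo 0 a) := by
    rcases K with _ | K
    · intro y hy w hw hyw
      simpa [altRemainder] using hG.antitoneOn hy.1 hw.1 hyw
    have hd : ∀ y ∈ Ioo 0 a, HasDerivAt (fun y => altRemainder G a (K + 1) 0 y / (a - y) ^ (K + 1))
        ((-(altRemainder G a K (0 + 1) y) * (a - y) ^ (K + 1) - altRemainder G a (K + 1) 0 y *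
          (((K + 1 : ℕ) : ℝ) * (a - y) ^ (K + 1 - 1) * (-1))) / ((a - y) ^ (K + 1)) ^ 2) y := by
      intro y hy
      exact (hG.hasDerivAt_altRemainder a K 0 hy.1).div (((hasDerivAt_id y).const_sub a).pow (K + 1))
        (pow_ne_zero _ (sub_pos.2 hy.2).ne')
    apply antitoneOn_of_deriv_nonpos (convex_Ioo 0 a)
    · exact fun y hy => (hd y hy).continuousAt.continuousWithinAt
    · rw [interior_Ioo]
      exact fun y hy => (hd y hy).differentiableAt.differentiableWithinAt
    · rw [interior_Ioo]
      intro y hy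
      rw [(hd y hy).deriv]
      apply div_nonpos_of_nonpos_of_nonneg _ (by positivity)
      have h1 := mul_nonneg (hG.altRemainder_succ_le ha K 0 hy.1 hy.2.le)
        (pow_nonneg (sub_pos.2 hy.2).le K)
      simp only [Nat.add_sub_cancel, pow_succ]
      push_cast
      linarith
  have hz' : 0 < a - z := by linarith
  have hx' : 0 < a - x := by linarith
  have := h ⟨hz, by linarith⟩ ⟨hz.trans_le hzx, hxa⟩ hzx
  simp only at this
  rw [div_le_iff₀ (by positivity)] at this
  calc _ ≤ _ := this
    _ = _ := by rw [div_pow]; ring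

/-- A completely monotone function is the sum of its Taylor series at `a` on `(0,a)`. -/
lemma hasSum_taylor (hG : AltDerivSeq G) {a x : ℝ} (hx : 0 < x) (hxa : x < a) :
    HasSum (fun k : ℕ => G k a / (k.factorial : ℝ) * (a - x) ^ k) (G 0 x) := by
  have ha : 0 < a := hx.trans hxa
  have hx' : 0 < a - x := by linarith
  rw [hasSum_iff_tendsto_nat_of_nonneg
    (fun k => mul_nonneg (div_nonneg (hG.nonneg k a ha) (by positivity)) (by positivity))]
  -- Any comparison point strictly between `0` and `x` would do: the ratio is below `1`, and the
  -- remainder there is at most `G 0 (x / 2)` for every `K`.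
  have hz : 0 < x / 2 := by linarith
  have hr0 : 0 ≤ (a - x) / (a - x / 2) := div_nonneg hx'.le (by linarith)
  have hr1 : (a - x) / (a - x / 2) < 1 := by rw [div_lt_one (by linarith)]; linarith
  have h0 : Tendsto (fun K => altRemainder G a K 0 x) atTop (𝓝 0) := by
    refine squeeze_zero (fun K => hG.altRemainder_nonneg ha K 0 hx hxa.le)
      (g := fun K => ((a - x) / (a - x / 2)) ^ K * G 0 (x / 2)) (fun K => ?_) ?_
    · refine (hG.altRemainder_mul_pow_le K hz (by linarith) hxa).trans ?_
      refine mul_le_mul_of_nonneg_left ?_ (by positivity)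
      simp only [altRemainder, sub_le_self_iff]
      refine Finset.sum_nonneg fun k _ => mul_nonneg (div_nonneg (hG.nonneg _ a ha) (by positivity))
        (pow_nonneg (by linarith) _)
    · simpa using (tendsto_pow_atTop_nhds_zero_of_lt_one hr0 hr1).mul_const (G 0 (x / 2))
  have := h0.const_sub (G 0 x)
  simpa [altRemainder] using this

end AltDerivSeq

/-! ### Complete monotonicity of `e^{-tf}` -/

lemma contDiffOn_iteratedDeriv {f : ℝ → ℝ} (hf : ContDiffOn ℝ ∞ f (Ioi 0)) (k : ℕ) :
    ContDiffOn ℝ ∞ (iteratedDeriv k f) (Ioi 0) := by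
  induction k with
  | zero => simpa using hf
  | succ k ih =>
    rw [iteratedDeriv_succ]
    exact ih.deriv_of_isOpen isOpen_Ioi (by simp)

lemma hasDerivAt_iteratedDeriv_of_contDiffOn {f : ℝ → ℝ} (hf : ContDiffOn ℝ ∞ f (Ioi 0)) (k : ℕ)
    {x : ℝ} (hx : 0 < x) : HasDerivAt (iteratedDeriv k f) (iteratedDeriv (k + 1) f x) x := by
  rw [iteratedDeriv_succ]
  exact (((contDiffOn_iteratedDeriv hf k).contDiffAt (Ioi_mem_nhds hx)).differentiableAt
    (by simp)).hasDerivAt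

lemma AltDerivSeq.of_sign {f : ℝ → ℝ} (hf : ContDiffOn ℝ ∞ f (Ioi 0))
    (h : ∀ k : ℕ, ∀ x : ℝ, 0 < x → 0 ≤ (-1) ^ k * iteratedDeriv k f x) :
    AltDerivSeq (fun k x => (-1) ^ k * iteratedDeriv k f x) where
  nonneg := h
  hasDerivAt k x hx := by
    refine ((hasDerivAt_iteratedDeriv_of_contDiffOn hf k hx).const_mul _).congr_deriv ?_
    rw [pow_succ]; ring

/-- If `f` is a Bernstein function, then `e^{-tf}` is completely monotone. -/
lemma IsBernstein.altDerivSeq_exp {f : ℝ → ℝ} (hf : IsBernstein f) {t : ℝ} (ht : 0 ≤ t) :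
    AltDerivSeq (fun k x => (-1) ^ k * iteratedDeriv k (fun r => Real.exp (-(t * f r))) x) := by
  have hF : ContDiffOn ℝ ∞ (fun r => Real.exp (-(t * f r))) (Ioi 0) :=
    Real.contDiff_exp.comp_contDiffOn (contDiffOn_const.mul hf.contDiffOn).neg
  refine AltDerivSeq.of_sign hF fun k => ?_
  induction k using Nat.strong_induction_on with
  | _ k ih =>
  intro x hx
  rcases k with _ | k
  · simp [Real.exp_nonneg]
  have hfx : ContDiffAt ℝ ∞ f x := hf.contDiffOn.contDiffAt (Ioi_mem_nhds hx)
  have hdf : ContDiffAt ℝ k (deriv f) x := by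
    have : ContDiffOn ℝ ∞ (deriv f) (Ioi 0) :=
      hf.contDiffOn.deriv_of_isOpen isOpen_Ioi (by simp)
    exact (this.contDiffAt (Ioi_mem_nhds hx)).of_le (mod_cast le_top)
  have hFx : ContDiffAt ℝ k (fun r => Real.exp (-(t * f r))) x :=
    (hF.contDiffAt (Ioi_mem_nhds hx)).of_le (mod_cast le_top)
  -- The Leibniz rule applied to `F' = -t f' F` expresses each derivative of `F` through those of
  -- lower order.
  have hev : deriv (fun r => Real.exp (-(t * f r))) =ᶠ[𝓝 x]
      fun r => (-t) * (deriv f * fun r => Real.exp (-(t * f r))) r := by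
    filter_upwards [Ioi_mem_nhds hx] with y hy
    have h1 := (hasDerivAt_iteratedDeriv_of_contDiffOn hf.contDiffOn 0 hy)
    simp only [iteratedDeriv_zero, zero_add, iteratedDeriv_one] at h1
    have h2 := ((h1.const_mul t).fun_neg.exp).deriv
    rw [h2, Pi.mul_apply]
    ring
  rw [iteratedDeriv_succ', hev.iteratedDeriv_eq, iteratedDeriv_const_mul_field,
    iteratedDeriv_mul hdf hFx, Finset.mul_sum, Finset.mul_sum]
  refine Finset.sum_nonneg fun i hi => ?_
  have hik : i ≤ k := Nat.lt_succ_iff.1 (Finset.mem_range.1 hi)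
  have h1 := hf.sign (i + 1) (by omega) x hx
  rw [iteratedDeriv_succ', Nat.add_sub_cancel] at h1
  have h2 := ih (k - i) (by omega) x hx
  have h3 := mul_nonneg ht (mul_nonneg (Nat.cast_nonneg (α := ℝ) (k.choose i)) (mul_nonneg h1 h2))
  have h4 : (-1 : ℝ) ^ (k + 1) = -((-1) ^ i * (-1) ^ (k - i)) := by
    rw [← pow_add, Nat.add_sub_cancel' hik, pow_succ]; ring
  rw [h4]
  calc _ ≤ _ := h3
    _ = _ := by ring

/-! ### Interlacing zeros and poles -/

open Polynomial in
/-- The numerator of `∑ j, c j / (u + a j)` has a root in each gap between consecutive poles. -/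
lemma exists_interlacing_factorization {n : ℕ} {a c : Fin (n + 1) → ℝ} (ha : StrictMono a)
    (hc : ∀ j, 0 < c j) :
    ∃ b : Fin n → ℝ, (∀ k, a k.castSucc < b k ∧ b k < a k.succ) ∧
      ∀ u, ∑ j, c j * ∏ i ∈ Finset.univ.erase j, (u + a i) = (∑ j, c j) * ∏ k, (u + b k) := by
  set N : ℝ → ℝ := fun u => ∑ j, c j * ∏ i ∈ Finset.univ.erase j, (u + a i) with hN
  have hNa : ∀ k, N (-a k) = c k * ∏ i ∈ Finset.univ.erase k, (a i - a k) := by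
    intro k
    simp only [hN]
    rw [Finset.sum_eq_single k]
    · simp only [neg_add_eq_sub]
    · intro j _ hjk
      rw [Finset.prod_eq_zero (i := k) (Finset.mem_erase.2 ⟨hjk.symm, Finset.mem_univ _⟩) (by simp),
        mul_zero]
    · simp
  have hNc : Continuous N := by fun_prop
  -- At `-a k` only the `k`-th summand survives. For neighbouring poles the factors from every other
  -- pole agree in sign, while the two factors from the gap itself have opposite signs.
  have hsign : ∀ k : Fin n, N (-a k.castSucc) * N (-a k.succ) < 0 := by
    intro k
    have hlt : k.castSucc < k.succ := Fin.castSucc_lt_succ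
    have hpos : 0 < ∏ i ∈ (Finset.univ.erase k.castSucc).erase k.succ,
        ((a i - a k.castSucc) * (a i - a k.succ)) := by
      refine Finset.prod_pos fun i hi => ?_
      simp only [Finset.mem_erase, Finset.mem_univ, and_true] at hi
      rcases lt_or_gt_of_ne hi.2 with h | h
      · exact mul_pos_of_neg_of_neg (sub_neg.2 (ha h)) (sub_neg.2 (ha (h.trans hlt)))
      · have h' : k.succ < i := lt_of_le_of_ne (Fin.castSucc_lt_iff_succ_le.1 h) hi.1.symm
        exact mul_pos (sub_pos.2 (ha h)) (sub_pos.2 (ha h'))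
    rw [hNa, hNa,
      ← Finset.mul_prod_erase _ _ (Finset.mem_erase.2 ⟨hlt.ne', Finset.mem_univ k.succ⟩),
      ← Finset.mul_prod_erase (Finset.univ.erase k.succ) _
        (Finset.mem_erase.2 ⟨hlt.ne, Finset.mem_univ k.castSucc⟩),
      Finset.erase_right_comm (s := Finset.univ) (a := k.succ)]
    rw [Finset.prod_mul_distrib] at hpos
    have h1 := sub_pos.2 (ha hlt)
    have h2 := mul_pos (mul_pos (mul_pos (hc k.castSucc) (hc k.succ)) hpos) (mul_pos h1 h1)
    linarith
  have hroot : ∀ k : Fin n, ∃ b, (a k.castSucc < b ∧ b < a k.succ) ∧ N (-b) = 0 := by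
    intro k
    have hlt := ha (Fin.castSucc_lt_succ (i := k))
    have hcont : ContinuousOn (fun b => N (-b)) (Icc (a k.castSucc) (a k.succ)) := by fun_prop
    have hs := hsign k
    rcases lt_or_ge (N (-a k.castSucc)) 0 with h | h
    · have h' : 0 < N (-a k.succ) := by
        by_contra! h'
        exact hs.not_ge (mul_nonneg_of_nonpos_of_nonpos h.le h')
      obtain ⟨b, hb, hb0⟩ := intermediate_value_Ioo hlt.le hcont ⟨h, h'⟩
      exact ⟨b, hb, hb0⟩
    · have h' : N (-a k.succ) < 0 := by
        by_contra! h'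
        exact hs.not_ge (mul_nonneg h h')
      have h'' : 0 < N (-a k.castSucc) := lt_of_le_of_ne h fun h0 => by simp [← h0] at hs
      obtain ⟨b, hb, hb0⟩ := intermediate_value_Ioo' hlt.le hcont ⟨h', h''⟩
      exact ⟨b, hb, hb0⟩
  choose b hb hb0 using hroot
  refine ⟨b, hb, ?_⟩
  have hbmono : StrictMono b := by
    intro k l hkl
    calc b k < a k.succ := (hb k).2
      _ ≤ a l.castSucc := ha.monotone (Fin.succ_le_castSucc_iff.2 hkl)
      _ < b l := (hb l).1
  set p : ℝ[X] := ∑ j, C (c j) * ∏ i ∈ Finset.univ.erase j, (X + C (a i)) with hp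
  set q : ℝ[X] := C (∑ j, c j) * ∏ k, (X + C (b k)) with hq
  have hpe : ∀ u, p.eval u = N u := by
    intro u
    simp [hp, hN, eval_finsetSum, eval_prod]
  have hqe : ∀ u, q.eval u = (∑ j, c j) * ∏ k, (u + b k) := by
    intro u
    simp [hq, eval_prod, eval_finsetSum]
  have hprodd : ∀ j : Fin (n + 1), (∏ i ∈ Finset.univ.erase j, (X + C (a i))).natDegree = n := by
    intro j
    rw [natDegree_prod_of_monic _ _ fun i _ => monic_X_add_C _]
    simp
  -- Both polynomials have coefficient `∑ j, c j` in degree `n`, so the difference has degree below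
  -- `n`; having the `n` distinct roots `-b k`, it is zero.
  have hdeg : (p - q).degree < n := by
    rw [degree_lt_iff_coeff_zero]
    intro m hm
    have h1 : ∀ j : Fin (n + 1), (∏ i ∈ Finset.univ.erase j, (X + C (a i)) : ℝ[X]).coeff m =
        if m = n then 1 else 0 := by
      intro j
      split_ifs with h
      · have := (monic_prod_of_monic (Finset.univ.erase j) (fun i => X + C (a i))
          fun i _ => monic_X_add_C _).coeff_natDegree
        rw [hprodd] at this
        exact (congrArg _ h).trans this
      · exact coeff_eq_zero_of_natDegree_lt (by rw [hprodd]; omega)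
    have h2 : (∏ k, (X + C (b k)) : ℝ[X]).coeff m = if m = n then 1 else 0 := by
      have hd : (∏ k, (X + C (b k)) : ℝ[X]).natDegree = n := by
        rw [natDegree_prod_of_monic _ _ fun i _ => monic_X_add_C _]
        simp
      split_ifs with h
      · have := (monic_prod_of_monic Finset.univ (fun k => X + C (b k))
          fun i _ => monic_X_add_C _).coeff_natDegree
        rw [hd] at this
        exact (congrArg _ h).trans this
      · exact coeff_eq_zero_of_natDegree_lt (by rw [hd]; omega)
    simp only [hp, hq, coeff_sub, finsetSum_coeff, coeff_C_mul, h1, h2]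
    rw [← Finset.sum_mul, sub_self]
  have hpq : p - q = 0 := by
    refine eq_zero_of_degree_lt_of_eval_index_eq_zero (s := Finset.univ) (v := fun k => -b k)
      (fun k _ l _ h => hbmono.injective (neg_injective h)) (by simpa using hdeg) fun k _ => ?_
    rw [eval_sub, hpe, hqe, hb0, Finset.prod_eq_zero (Finset.mem_univ k) (by simp)]
    simp
  intro u
  rw [← hqe, ← sub_eq_zero.1 hpq, hpe]

/-- Logarithm of a finite Stieltjes sum in terms of interlacing poles and zeros. -/
lemma exists_neg_log_sum_div {n : ℕ} {a c : Fin (n + 1) → ℝ} (ha : StrictMono a)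
    (ha0 : ∀ j, 0 < a j) (hc : ∀ j, 0 < c j) :
    ∃ b : Fin n → ℝ, (∀ k, a k.castSucc < b k) ∧ ∀ u, 0 ≤ u →
      -Real.log ((∑ j, c j / (u + a j)) / ∑ j, c j / (0 + a j)) =
        ∑ k, (Real.log (1 + u / a k.castSucc) - Real.log (1 + u / b k)) +
          Real.log (1 + u / a (Fin.last n)) := by
  obtain ⟨b, hb, hN⟩ := exists_interlacing_factorization ha hc
  have hb0 : ∀ k, 0 < b k := fun k => (ha0 _).trans (hb k).1
  refine ⟨b, fun k => (hb k).1, fun u hu => ?_⟩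
  have hS : 0 < ∑ j, c j := Finset.sum_pos (fun j _ => hc j) Finset.univ_nonempty
  have hh : ∀ u, 0 ≤ u →
      ∑ j, c j / (u + a j) = ((∑ j, c j) * ∏ k, (u + b k)) / ∏ j, (u + a j) := by
    intro u hu
    rw [← hN, Finset.sum_div]
    refine Finset.sum_congr rfl fun j _ => ?_
    rw [← Finset.mul_prod_erase Finset.univ _ (Finset.mem_univ j)]
    have h1 : u + a j ≠ 0 := (add_pos_of_nonneg_of_pos hu (ha0 j)).ne'
    have h2 : ∏ i ∈ Finset.univ.erase j, (u + a i) ≠ 0 :=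
      Finset.prod_ne_zero_iff.2 fun i _ => (add_pos_of_nonneg_of_pos hu (ha0 i)).ne'
    field_simp
  have hlog : ∀ u, 0 ≤ u → Real.log (∑ j, c j / (u + a j)) = Real.log (∑ j, c j) +
      ∑ k, Real.log (u + b k) - ∑ j, Real.log (u + a j) := by
    intro u hu
    have hb' : ∀ k, u + b k ≠ 0 := fun k => (add_pos_of_nonneg_of_pos hu (hb0 k)).ne'
    have ha' : ∀ k, u + a k ≠ 0 := fun k => (add_pos_of_nonneg_of_pos hu (ha0 k)).ne'
    rw [hh u hu, Real.log_div (mul_ne_zero hS.ne' (Finset.prod_ne_zero_iff.2 fun i _ => hb' i))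
      (Finset.prod_ne_zero_iff.2 fun i _ => ha' i),
      Real.log_mul hS.ne' (Finset.prod_ne_zero_iff.2 fun i _ => hb' i),
      Real.log_prod fun i _ => hb' i, Real.log_prod fun i _ => ha' i]
  have hpos : ∀ u, 0 ≤ u → ∑ j, c j / (u + a j) ≠ 0 := fun u hu =>
    (Finset.sum_pos (fun j _ => div_pos (hc j) (add_pos_of_nonneg_of_pos hu (ha0 j)))
      Finset.univ_nonempty).ne'
  have h1 : ∀ {x : ℝ}, 0 < x → Real.log (1 + u / x) = Real.log (u + x) - Real.log (0 + x) := by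
    intro x hx
    rw [← Real.log_div (by positivity) (by positivity)]
    congr 1
    field_simp
    ring
  rw [Real.log_div (hpos u hu) (hpos 0 le_rfl), hlog u hu, hlog 0 le_rfl, h1 (ha0 _)]
  simp_rw [h1 (ha0 _), h1 (hb0 _)]
  rw [Fin.sum_univ_castSucc (fun j => Real.log (u + a j)),
    Fin.sum_univ_castSucc (fun j => Real.log (0 + a j))]
  simp only [Finset.sum_sub_distrib]
  ring

/-! ### The cone of mixtures and its closedness -/

/-- The extreme complete Bernstein functions, normalised at `1` and indexed by `[0,1]`:
`τ = λ / (1 + λ)` corresponds to `u (1 + λ) / (u + λ)`. -/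
noncomputable def cbfKernel (u : ℝ) (τ : Icc (0 : ℝ) 1) : ℝ := u / (u * (1 - τ) + τ)

/-- Functions which on `(0,∞)` are mixtures of extreme complete Bernstein functions. -/
def cbfCone : Set (ℝ → ℝ) :=
  {g | ∃ σ : FiniteMeasure (Icc (0 : ℝ) 1), ∀ u, 0 < u → g u = ∫ τ, cbfKernel u τ ∂σ}

lemma cbfKernel_denom_pos {u : ℝ} (hu : 0 < u) (τ : Icc (0 : ℝ) 1) :
    0 < u * (1 - (τ : ℝ)) + τ := by
  obtain ⟨τ, h0, h1⟩ := τ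
  rcases h0.eq_or_lt with rfl | h
  · simpa using hu
  · have := mul_nonneg hu.le (sub_nonneg.2 h1)
    simp only
    linarith

lemma continuous_cbfKernel {u : ℝ} (hu : 0 < u) : Continuous (cbfKernel u) :=
  continuous_const.div (by fun_prop) fun τ => (cbfKernel_denom_pos hu τ).ne'

lemma integrable_cbfKernel {u : ℝ} (hu : 0 < u) (σ : Measure (Icc (0 : ℝ) 1)) [IsFiniteMeasure σ] :
    Integrable (cbfKernel u) σ :=
  (continuous_cbfKernel hu).integrable_of_hasCompactSupport (HasCompactSupport.of_compactSpace _)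

lemma cbfKernel_one (τ : Icc (0 : ℝ) 1) : cbfKernel 1 τ = 1 := by
  simp [cbfKernel]

lemma integral_cbfKernel_one (σ : FiniteMeasure (Icc (0 : ℝ) 1)) :
    ∫ τ, cbfKernel 1 τ ∂σ = σ.mass := by
  simp only [cbfKernel_one, integral_const, smul_eq_mul, mul_one]
  rfl

lemma zero_mem_cbfCone : (0 : ℝ → ℝ) ∈ cbfCone := ⟨0, fun u _ => by simp⟩

lemma add_mem_cbfCone {g h : ℝ → ℝ} (hg : g ∈ cbfCone) (hh : h ∈ cbfCone) : g + h ∈ cbfCone := by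
  obtain ⟨σ, hσ⟩ := hg
  obtain ⟨ρ, hρ⟩ := hh
  refine ⟨σ + ρ, fun u hu => ?_⟩
  rw [FiniteMeasure.toMeasure_add, integral_add_measure (integrable_cbfKernel hu _)
    (integrable_cbfKernel hu _), Pi.add_apply, hσ u hu, hρ u hu]

lemma sum_mem_cbfCone {ι : Type*} (s : Finset ι) {g : ι → ℝ → ℝ}
    (hg : ∀ i ∈ s, g i ∈ cbfCone) : ∑ i ∈ s, g i ∈ cbfCone :=
  Finset.sum_induction _ (· ∈ cbfCone) (fun _ _ => add_mem_cbfCone) zero_mem_cbfCone hg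

/-- Measures of mass at most `C` on a compact space are weakly compact, and each kernel with `u > 0`
is continuous in `τ`, so the image is compact. -/
lemma isClosed_image_cbfCone (C : ℝ≥0) :
    IsClosed ((fun (σ : FiniteMeasure (Icc (0 : ℝ) 1)) (u : Ioi (0 : ℝ)) =>
      ∫ τ, cbfKernel u τ ∂σ) '' {σ | σ.mass ≤ C}) := by
  refine ((isCompact_setOfPred_finiteMeasure_le_of_compactSpace _ C).image ?_).isClosed
  refine continuous_pi fun u => ?_
  exact FiniteMeasure.continuous_integral_boundedContinuousFunction
    (BoundedContinuousFunction.mkOfCompact ⟨cbfKernel u, continuous_cbfKernel u.2⟩)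

/-- Pointwise limits on `(0,∞)` of mixtures of extreme complete Bernstein functions are again such
mixtures. -/
lemma mem_cbfCone_of_tendsto {ι : Type*} {l : Filter ι} [l.NeBot] {g : ι → ℝ → ℝ} {h : ℝ → ℝ}
    (hg : ∀ᶠ i in l, g i ∈ cbfCone) (hh : ∀ u, 0 < u → Tendsto (fun i => g i u) l (𝓝 (h u))) :
    h ∈ cbfCone := by
  -- The kernels equal `1` at `u = 1`, so the mass of a mixing measure is `g i 1`, which tends to `h
  -- 1`.
  set C : ℝ≥0 := Real.toNNReal (h 1 + 1)
  have h1 : ∀ᶠ i in l, g i 1 < h 1 + 1 := (hh 1 one_pos).eventually_lt_const (by linarith)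
  have hmem : ∀ᶠ i in l, (fun u : Ioi (0 : ℝ) => g i u) ∈
      (fun (σ : FiniteMeasure (Icc (0 : ℝ) 1)) (u : Ioi (0 : ℝ)) =>
        ∫ τ, cbfKernel u τ ∂σ) '' {σ | σ.mass ≤ C} := by
    filter_upwards [hg, h1] with i ⟨σ, hσ⟩ hi
    refine ⟨σ, ?_, funext fun u => (hσ u u.2).symm⟩
    rw [hσ 1 one_pos, integral_cbfKernel_one] at hi
    exact NNReal.le_toNNReal_of_coe_le hi.le
  obtain ⟨σ, -, hσ⟩ := (isClosed_image_cbfCone C).mem_of_tendsto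
    (tendsto_pi_nhds.2 fun u => hh u u.2) hmem
  exact ⟨σ, fun u hu => (congrFun hσ ⟨u, hu⟩).symm⟩

lemma integral_Ioc_div_mul_add {a b u : ℝ} (ha : 0 < a) (hab : a ≤ b) (hu : 0 < u) :
    ∫ x in Ioc a b, u / (x * (x + u)) = Real.log (1 + u / a) - Real.log (1 + u / b) := by
  have hpos : ∀ x ∈ uIcc a b, 0 < x := fun x hx => ha.trans_le (uIcc_of_le hab ▸ hx).1
  have hb := ha.trans_le hab
  rw [← intervalIntegral.integral_of_le hab,
    intervalIntegral.integral_eq_sub_of_hasDerivAt (f := fun x => Real.log x - Real.log (x + u))]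
  · have h1 : ∀ {x : ℝ}, 0 < x → Real.log (1 + u / x) = Real.log (x + u) - Real.log x := by
      intro x hx
      rw [← Real.log_div (by positivity) (by positivity)]
      congr 1
      field_simp
    rw [h1 ha, h1 hb]
    ring
  · intro x hx
    have hx := hpos x hx
    refine ((Real.hasDerivAt_log hx.ne').sub
      (((hasDerivAt_id x).add_const u).log (by simp only [id]; positivity))).congr_deriv ?_
    simp only [id]
    field_simp
    ring
  · refine ContinuousOn.intervalIntegrable ?_
    refine continuousOn_const.div (by fun_prop) fun x hx => ?_
    have hx := hpos x hx
    positivity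

/-- The integrand `u / (x (x + u))` is `1 / (x (1 + x))` times the kernel at `τ = x / (1 + x)`, so
the mixing measure is a pushforward under `T`; `projIcc` only supplies the codomain. -/
lemma log_sub_log_mem_cbfCone {a b : ℝ} (ha : 0 < a) (hab : a ≤ b) :
    (fun u => Real.log (1 + u / a) - Real.log (1 + u / b)) ∈ cbfCone := by
  set T : ℝ → Icc (0 : ℝ) 1 := fun x => projIcc 0 1 zero_le_one (x / (1 + x)) with hT
  have hTm : Measurable T := continuous_projIcc.measurable.comp (by fun_prop)
  set w : ℝ → ℝ≥0 := fun x => Real.toNNReal (1 / (x * (1 + x))) with hw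
  have hwm : Measurable w := by fun_prop
  set ν : Measure ℝ := (volume.restrict (Ioc a b)).withDensity fun x => (w x : ENNReal) with hν
  have hfin : IsFiniteMeasure ν := by
    refine isFiniteMeasure_withDensity_ofReal (f := fun x => 1 / (x * (1 + x))) ?_
    refine (IntegrableOn.mono_set (ContinuousOn.integrableOn_Icc ?_) Ioc_subset_Icc_self).2
    refine continuousOn_const.div (by fun_prop) fun x hx => ?_
    have hx := ha.trans_le hx.1
    positivity
  refine ⟨⟨ν.map T, inferInstance⟩, fun u hu => ?_⟩
  rw [FiniteMeasure.toMeasure_mk, integral_map hTm.aemeasurable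
    (continuous_cbfKernel hu).aestronglyMeasurable, hν, integral_withDensity_eq_integral_smul hwm]
  beta_reduce
  rw [← integral_Ioc_div_mul_add ha hab hu]
  refine setIntegral_congr_fun measurableSet_Ioc fun x hx => ?_
  have hx : 0 < x := ha.trans hx.1
  have h01 : x / (1 + x) ∈ Icc (0 : ℝ) 1 :=
    ⟨by positivity, by rw [div_le_one (by positivity)]; linarith⟩
  simp only [hT, hw, cbfKernel, projIcc_of_mem zero_le_one h01, NNReal.smul_def, smul_eq_mul]
  rw [Real.coe_toNNReal _ (by positivity)]
  have h2 : u * (1 - x / (1 + x)) + x / (1 + x) = (x + u) / (1 + x) := by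
    field_simp
    ring
  rw [h2]
  field_simp

lemma log_mem_cbfCone {a : ℝ} (ha : 0 < a) : (fun u => Real.log (1 + u / a)) ∈ cbfCone := by
  refine mem_cbfCone_of_tendsto (l := atTop)
    (g := fun b u => Real.log (1 + u / a) - Real.log (1 + u / b)) ?_ fun u hu => ?_
  · filter_upwards [eventually_ge_atTop a] with b hb using log_sub_log_mem_cbfCone ha hb
  · have h1 : Tendsto (fun b : ℝ => 1 + u / b) atTop (𝓝 (1 + 0)) :=
      (tendsto_const_nhds.div_atTop tendsto_id).const_add 1
    have h2 := (Real.continuousAt_log (by norm_num : (1 + 0 : ℝ) ≠ 0)).tendsto.comp h1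
    simpa using h2.const_sub (Real.log (1 + u / a))

/-! ### Logarithms of Stieltjes functions -/

/-- Functions which on `[0,∞)` are finite sums `∑ c_j / (u + a_j)`, with strictly
increasing positive poles. -/
def finiteStieltjes : Set (ℝ → ℝ) :=
  {h | ∃ (n : ℕ) (a c : Fin (n + 1) → ℝ), StrictMono a ∧ (∀ j, 0 < a j) ∧ (∀ j, 0 < c j) ∧
    ∀ u, 0 ≤ u → h u = ∑ j, c j / (u + a j)}

lemma neg_log_div_mem_cbfCone_of_finiteStieltjes {h : ℝ → ℝ} (hh : h ∈ finiteStieltjes) :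
    (fun u => -Real.log (h u / h 0)) ∈ cbfCone := by
  obtain ⟨n, a, c, ha, ha0, hc, hh⟩ := hh
  obtain ⟨b, hb, hlog⟩ := exists_neg_log_sum_div ha ha0 hc
  have h1 := add_mem_cbfCone (sum_mem_cbfCone Finset.univ (fun k _ =>
    log_sub_log_mem_cbfCone (ha0 (Fin.castSucc k)) (hb k).le)) (log_mem_cbfCone (ha0 (Fin.last n)))
  obtain ⟨σ, hσ⟩ := h1
  refine ⟨σ, fun u hu => ?_⟩
  rw [← hσ u hu]
  beta_reduce
  rw [hh u hu.le, hh 0 le_rfl, hlog u hu.le]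
  simp

/-- Each `u c / (u + a)` increases with `u`, and the inequality is a closed condition for pointwise
convergence. -/
lemma mul_le_mul_of_mem_closure {h : ℝ → ℝ} (hh : h ∈ closure finiteStieltjes) {u v : ℝ}
    (hv : 0 ≤ v) (huv : v ≤ u) : v * h v ≤ u * h u := by
  have hcl : IsClosed {h : ℝ → ℝ | v * h v ≤ u * h u} :=
    isClosed_le (by fun_prop) (by fun_prop)
  refine hcl.closure_subset_iff.2 ?_ hh
  rintro k ⟨n, a, c, -, ha0, hc, hk⟩
  rw [mem_ofPred_eq, hk u (hv.trans huv), hk v hv, Finset.mul_sum, Finset.mul_sum]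
  refine Finset.sum_le_sum fun j _ => ?_
  have h1 := ha0 j
  have h2 := hc j
  rw [mul_div_assoc', mul_div_assoc', div_le_div_iff₀ (by positivity) (by linarith)]
  nlinarith [mul_le_mul_of_nonneg_left huv (mul_pos h2 h1).le]

/-- Monotonicity of `u * h u` says nothing at `0`, so right continuity first moves positivity to a
small `v > 0`. -/
lemma pos_of_mem_closure {h : ℝ → ℝ} (hh : h ∈ closure finiteStieltjes) (h0 : 0 < h 0)
    (hc : ContinuousWithinAt h (Ici 0) 0) {u : ℝ} (hu : 0 ≤ u) : 0 < h u := by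
  rcases hu.eq_or_lt with rfl | hu
  · exact h0
  have hc' : Tendsto h (𝓝[>] 0) (𝓝 (h 0)) := hc.mono_left (nhdsWithin_mono _ Ioi_subset_Ici_self)
  obtain ⟨v, ⟨hv, hvu⟩, hv0, -⟩ := ((hc'.eventually_const_lt h0).and
    (Ioo_mem_nhdsGT hu)).exists.imp fun v hv => (⟨⟨hv.1, hv.2.2.le⟩, hv.2.1, trivial⟩ :
      (0 < h v ∧ v ≤ u) ∧ 0 < v ∧ True)
  exact pos_of_mul_pos_right
    ((mul_pos hv0 hv).trans_le (mul_le_mul_of_mem_closure hh hv0.le hvu)) hu.le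

/-- The logarithm of a Stieltjes function, normalised at `0`, is minus a mixture of extreme
complete Bernstein functions. -/
lemma neg_log_div_mem_cbfCone {h : ℝ → ℝ} (hh : h ∈ closure finiteStieltjes) (h0 : 0 < h 0)
    (hc : ContinuousWithinAt h (Ici 0) 0) : (fun u => -Real.log (h u / h 0)) ∈ cbfCone := by
  have hne := mem_closure_iff_nhdsWithin_neBot.1 hh
  refine mem_cbfCone_of_tendsto (l := 𝓝[finiteStieltjes] h)
    (g := fun k u => -Real.log (k u / k 0)) ?_ fun u hu => ?_
  · filter_upwards [self_mem_nhdsWithin] with k hk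
      using neg_log_div_mem_cbfCone_of_finiteStieltjes hk
  · have hev : ∀ u, Tendsto (fun k : ℝ → ℝ => k u) (𝓝[finiteStieltjes] h) (𝓝 (h u)) := fun u =>
      ((continuous_apply u).tendsto h).mono_left nhdsWithin_le_nhds
    exact (((hev u).div (hev 0) h0.ne').log
      (div_pos (pos_of_mem_closure hh h0 hc hu.le) h0).ne').neg

/-! ### Laplace transforms and the Lévy–Khintchine formula -/

lemma IsCompletelyMonotone.congr {m m' : ℝ → ℝ} (hm : IsCompletelyMonotone m)
    (h : EqOn m' m (Ioi 0)) : IsCompletelyMonotone m' where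
  contDiffOn := hm.contDiffOn.congr h
  sign k x hx := by
    rw [h.iteratedDeriv_of_isOpen isOpen_Ioi k hx]
    exact hm.sign k x hx

lemma IsCompletelyMonotone.const_add {m : ℝ → ℝ} (hm : IsCompletelyMonotone m) {b : ℝ}
    (hb : 0 ≤ b) : IsCompletelyMonotone (fun x => b + m x) where
  contDiffOn := contDiffOn_const.add hm.contDiffOn
  sign k x hx := by
    rcases k with _ | k
    · simpa using add_nonneg hb (by simpa using hm.sign 0 x hx)
    · have h := hm.sign (k + 1) x hx
      rw [iteratedDeriv_succ'] at h ⊢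
      simpa using h

/-- Laplace transforms of measures on `[0,∞)` are completely monotone. -/
lemma isCompletelyMonotone_mgf_neg {α : Type*} [MeasurableSpace α] {ρ : Measure α} {X : α → ℝ}
    (hX : ∀ x, 0 ≤ X x) (hint : ∀ s, 0 < s → Integrable (fun x => Real.exp (-s * X x)) ρ) :
    IsCompletelyMonotone (fun s => mgf X ρ (-s)) := by
  have hsub : Iio 0 ⊆ interior (integrableExpSet X ρ) := by
    refine interior_maximal (fun s hs => ?_) isOpen_Iio
    simpa [integrableExpSet] using hint (-s) (neg_pos.2 hs)
  constructor
  · intro s hs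
    have hs : 0 < s := hs
    have h1 := (analyticAt_mgf (hsub (neg_lt_zero.2 hs : -s ∈ Iio 0))).contDiffAt (n := ∞)
    exact (h1.comp s contDiff_neg.contDiffAt).contDiffWithinAt
  · intro k s hs
    rw [iteratedDeriv_comp_neg, iteratedDeriv_mgf (hsub (neg_lt_zero.2 hs : -s ∈ Iio 0)),
      smul_eq_mul, ← mul_assoc, ← mul_pow]
    simp only [mul_neg, mul_one, neg_neg, one_pow, one_mul]
    exact integral_nonneg fun x => mul_nonneg (pow_nonneg (hX x) k) (Real.exp_nonneg _)

lemma IsBernstein.of_hasDerivAt {g g' : ℝ → ℝ} (h0 : Tendsto g (𝓝[>] 0) (𝓝 (g 0)))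
    (hg : ∀ x, 0 < x → 0 ≤ g x) (hd : ∀ x, 0 < x → HasDerivAt g (g' x) x)
    (hg' : IsCompletelyMonotone g') : IsBernstein g := by
  have hdg : IsCompletelyMonotone (deriv g) := hg'.congr fun x hx => (hd x hx).deriv
  refine ⟨h0, ?_, hg, ?_⟩
  · rw [contDiffOn_infty_iff_deriv_of_isOpen isOpen_Ioi]
    exact ⟨fun x hx => (hd x hx).differentiableAt.differentiableWithinAt, hdg.contDiffOn⟩
  · intro k hk x hx
    obtain ⟨k, rfl⟩ := Nat.exists_eq_add_of_le' hk
    rw [iteratedDeriv_succ']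
    exact hdg.sign k x hx

lemma one_sub_exp_neg_nonneg {x : ℝ} (hx : 0 ≤ x) : 0 ≤ 1 - Real.exp (-x) :=
  sub_nonneg.2 (Real.exp_le_one_iff.2 (by linarith))

lemma mul_exp_neg_le {x : ℝ} : x * Real.exp (-x) ≤ 1 - Real.exp (-x) := by
  have h := Real.add_one_le_exp x
  have h2 : Real.exp x * Real.exp (-x) = 1 := by rw [← Real.exp_add]; simp
  nlinarith [Real.exp_pos (-x)]

lemma min_one_le {s : ℝ} (hs : 0 < s) : min 1 s ≤ 2 * (1 - Real.exp (-s)) := by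
  have h := Real.add_one_le_exp s
  have h2 : Real.exp (-s) ≤ 1 / (1 + s) := by
    rw [Real.exp_neg, ← one_div]
    exact one_div_le_one_div_of_le (by linarith) (by linarith)
  have h3 : min 1 s ≤ 2 * (1 - 1 / (1 + s)) := by
    have h4 : 2 * (1 - 1 / (1 + s)) = 2 * s / (1 + s) := by field_simp; ring
    rw [h4, le_div_iff₀ (by linarith)]
    rcases le_total 1 s with h | h
    · rw [min_eq_left h]; linarith
    · rw [min_eq_right h]; nlinarith
  linarith

/-- A function given by the Lévy–Khintchine formula with a completely monotone density is a
complete Bernstein function. -/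
lemma isCompleteBernstein_of_levyKhintchine {g m : ℝ → ℝ} {a b : ℝ} (ha : 0 ≤ a) (hb : 0 ≤ b)
    (h0 : Tendsto g (𝓝[>] 0) (𝓝 (g 0))) (hm : IsCompletelyMonotone m)
    (hint : ∀ u, 0 < u → IntegrableOn (fun s => (1 - Real.exp (-(u * s))) * m s) (Ioi 0))
    (hg : ∀ u, 0 < u → g u = a + b * u + ∫ s in Ioi (0 : ℝ), (1 - Real.exp (-(u * s))) * m s) :
    IsCompleteBernstein g := by
  have hm0 : ∀ s, 0 < s → 0 ≤ m s := fun s hs => by simpa using hm.sign 0 s hs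
  have hmm : AEStronglyMeasurable m (volume.restrict (Ioi 0)) :=
    hm.contDiffOn.continuousOn.aestronglyMeasurable measurableSet_Ioi
  have hsm : ∀ c, 0 < c → IntegrableOn (fun s => s * Real.exp (-(c * s)) * m s) (Ioi 0) := by
    intro c hc
    refine Integrable.mono' ((hint c hc).const_mul c⁻¹) ?_ ?_
    · exact (Continuous.aestronglyMeasurable (by fun_prop)).mul hmm
    · filter_upwards [self_mem_ae_restrict measurableSet_Ioi] with s hs
      have hs : 0 < s := hs
      rw [Real.norm_of_nonneg (mul_nonneg (by positivity) (hm0 s hs)), ← mul_assoc]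
      refine mul_le_mul_of_nonneg_right ?_ (hm0 s hs)
      have := mul_exp_neg_le (x := c * s)
      rw [le_inv_mul_iff₀ hc]
      linarith
  -- The derivative of `g` is `b` plus the Laplace transform of `s m(s) ds`. Below, `max s 0` equals
  -- `s` on the half-line and is nonnegative everywhere.
  set κ : ℝ → ℝ≥0 := fun s => Real.toNNReal (s * m s) with hκ
  have hκm : AEMeasurable κ (volume.restrict (Ioi 0)) :=
    (aemeasurable_id.mul hmm.aemeasurable).real_toNNReal
  set ρ : Measure ℝ := (volume.restrict (Ioi 0)).withDensity fun s => (κ s : ENNReal) with hρ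
  set X : ℝ → ℝ := fun s => max s 0 with hX
  have hexp : ∀ u, EqOn (fun s => κ s • Real.exp (-u * X s))
      (fun s => s * Real.exp (-(u * s)) * m s) (Ioi 0) := by
    intro u s hs
    have hs : 0 < s := hs
    simp only [hκ, hX, max_eq_left hs.le, NNReal.smul_def, smul_eq_mul,
      Real.coe_toNNReal _ (mul_nonneg hs.le (hm0 s hs)), neg_mul]
    ring
  have hcm : IsCompletelyMonotone (fun u => b + mgf X ρ (-u)) := by
    refine (isCompletelyMonotone_mgf_neg (fun s => le_max_right _ _) fun u hu => ?_).const_add hb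
    rw [hρ, integrable_withDensity_iff_integrable_smul₀ hκm]
    exact (integrableOn_congr_fun (hexp u) measurableSet_Ioi).2 (hsm u hu)
  have hmgf : ∀ u, mgf X ρ (-u) = ∫ s in Ioi (0 : ℝ), s * Real.exp (-(u * s)) * m s := by
    intro u
    rw [mgf, hρ, integral_withDensity_eq_integral_smul₀ hκm]
    exact setIntegral_congr_fun measurableSet_Ioi (hexp u)
  have hder : ∀ u, 0 < u → HasDerivAt g (b + mgf X ρ (-u)) u := by
    intro u hu
    have hnb : ∀ v ∈ Ioi (u / 2), 0 < v := fun v hv => (half_pos hu).trans hv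
    have h1 := (hasDerivAt_integral_of_dominated_loc_of_deriv_le
      (μ := volume.restrict (Ioi (0 : ℝ))) (F := fun u s => (1 - Real.exp (-(u * s))) * m s)
      (F' := fun u s => s * Real.exp (-(u * s)) * m s) (x₀ := u)
      (bound := fun s => s * Real.exp (-(u / 2 * s)) * m s)
      (Ioi_mem_nhds (half_lt_self hu)) (Eventually.of_forall fun v =>
        (Continuous.aestronglyMeasurable (by fun_prop)).mul hmm) (hint u hu)
      ((Continuous.aestronglyMeasurable (by fun_prop)).mul hmm) ?_ (hsm _ (half_pos hu)) ?_).2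
    · rw [hmgf]
      have h2 := (((hasDerivAt_id u).const_mul b).const_add a).add h1
      refine (h2.congr_of_eventuallyEq ?_).congr_deriv (by simp)
      filter_upwards [Ioi_mem_nhds hu] with v hv
      rw [hg v hv]
      simp
    · filter_upwards [self_mem_ae_restrict measurableSet_Ioi] with s hs v hv
      have hs : 0 < s := hs
      have hv : u / 2 < v := hv
      rw [Real.norm_of_nonneg (mul_nonneg (by positivity) (hm0 s hs))]
      refine mul_le_mul_of_nonneg_right ?_ (hm0 s hs)
      gcongr
    · filter_upwards with s v _
      have h3 : HasDerivAt (fun v => -(v * s)) (-s) v := by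
        simpa using ((hasDerivAt_id v).mul_const s).fun_neg
      refine ((h3.exp.const_sub 1).mul_const (m s)).congr_deriv (by ring)
  refine ⟨IsBernstein.of_hasDerivAt h0 (fun u hu => ?_) hder hcm, a, b, m, ha, hb, hm, ?_, hg⟩
  · rw [hg u hu]
    refine add_nonneg (by positivity) (setIntegral_nonneg measurableSet_Ioi fun s hs => ?_)
    exact mul_nonneg (one_sub_exp_neg_nonneg (mul_nonneg hu.le (le_of_lt hs))) (hm0 s hs)
  · refine Integrable.mono' ((hint 1 one_pos).const_mul 2) ?_ ?_
    · exact (Continuous.aestronglyMeasurable (by fun_prop)).mul hmm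
    · filter_upwards [self_mem_ae_restrict measurableSet_Ioi] with s hs
      have hs : 0 < s := hs
      rw [Real.norm_of_nonneg (mul_nonneg (by positivity) (hm0 s hs)), ← mul_assoc, one_mul]
      exact mul_le_mul_of_nonneg_right (min_one_le hs) (hm0 s hs)

/-! ### From mixtures to Lévy densities -/

/-- The decay rate `τ / (1 - τ)` attached to `τ ∈ [0,1]`, with value `0` at `τ = 1`. -/
noncomputable def decayRate (τ : Icc (0 : ℝ) 1) : ℝ := τ / (1 - τ)

lemma decayRate_nonneg (τ : Icc (0 : ℝ) 1) : 0 ≤ decayRate τ :=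
  div_nonneg τ.2.1 (sub_nonneg.2 τ.2.2)

lemma measurable_decayRate : Measurable decayRate := by
  unfold decayRate
  fun_prop

lemma decayRate_pos {τ : Icc (0 : ℝ) 1} (h0 : τ ≠ 0) (h1 : τ ≠ 1) : 0 < decayRate τ := by
  refine div_pos (lt_of_le_of_ne τ.2.1 fun h => h0 (Subtype.ext h.symm))
    (sub_pos.2 (lt_of_le_of_ne τ.2.2 fun h => h1 (Subtype.ext h)))

lemma integrableOn_levy_kernel {u r : ℝ} (hu : 0 < u) (hr : 0 < r) :
    IntegrableOn (fun s => r * (1 + r) * Real.exp (-s * r) * (1 - Real.exp (-(u * s)))) (Ioi 0) ∧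
    ∫ s in Ioi (0 : ℝ), r * (1 + r) * Real.exp (-s * r) * (1 - Real.exp (-(u * s))) =
      u * (1 + r) / (u + r) := by
  have h1 : (fun s => r * (1 + r) * Real.exp (-s * r) * (1 - Real.exp (-(u * s)))) =
      fun s => r * (1 + r) * (Real.exp (-r * s) - Real.exp (-(u + r) * s)) := by
    ext s
    rw [show -(u + r) * s = -s * r + -(u * s) by ring, Real.exp_add,
      show -r * s = -s * r by ring]
    ring
  have i1 := integrableOn_exp_mul_Ioi (a := -r) (by linarith) 0
  have i2 := integrableOn_exp_mul_Ioi (a := -(u + r)) (by linarith) 0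
  rw [h1]
  refine ⟨(i1.sub i2).const_mul _, ?_⟩
  rw [integral_const_mul, integral_sub i1 i2, integral_exp_mul_Ioi (by linarith),
    integral_exp_mul_Ioi (by linarith)]
  simp only [mul_zero, Real.exp_zero]
  have : u + r ≠ 0 := by positivity
  field_simp
  ring

/-- Interior `τ` have a Lévy density. At `τ = 0` and `τ = 1` the kernel is the constant `1` and the
linear `u`; there `decayRate` is `0` and the left side vanishes, whence the indicators. -/
lemma levy_kernel_eq {u : ℝ} (hu : 0 < u) (τ : Icc (0 : ℝ) 1) :
    IntegrableOn (fun s => decayRate τ * (1 + decayRate τ) * Real.exp (-s * decayRate τ) *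
      (1 - Real.exp (-(u * s)))) (Ioi 0) ∧
    ∫ s in Ioi (0 : ℝ), decayRate τ * (1 + decayRate τ) * Real.exp (-s * decayRate τ) *
      (1 - Real.exp (-(u * s))) =
      cbfKernel u τ - indicator {0} (fun _ => (1 : ℝ)) τ - indicator {1} (fun _ => u) τ := by
  by_cases h0 : τ = 0
  · subst h0
    simp [decayRate, cbfKernel, hu.ne']
  by_cases h1 : τ = 1
  · subst h1
    simp [decayRate, cbfKernel]
  have hr := decayRate_pos h0 h1
  obtain ⟨hi, he⟩ := integrableOn_levy_kernel hu hr
  refine ⟨hi, he.trans ?_⟩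
  rw [indicator_of_notMem (by simpa using h0), indicator_of_notMem (by simpa using h1)]
  have h2 : 0 < 1 - (τ : ℝ) := sub_pos.2 (lt_of_le_of_ne τ.2.2 fun h => h1 (Subtype.ext h))
  have h3 := cbfKernel_denom_pos hu τ
  simp only [decayRate, cbfKernel, sub_zero]
  have h4 : u + (τ : ℝ) / (1 - τ) ≠ 0 := by
    have := decayRate_nonneg τ
    unfold decayRate at this
    linarith
  have h5 : u + (τ : ℝ) / (1 - τ) = (u * (1 - τ) + τ) / (1 - τ) := by field_simp
  have h6 : 1 + (τ : ℝ) / (1 - τ) = 1 / (1 - τ) := by field_simp; ring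
  rw [h5, h6]
  field_simp

/-- Integrating `levy_kernel_eq` against `σ` and applying Fubini gives the formula, the atoms at `0`
and `1` becoming `a` and `b`. Membership in the cone does not constrain `g 0`, hence the hypothesis
`h0`. -/
lemma isCompleteBernstein_of_mem_cbfCone {g : ℝ → ℝ} (hg : g ∈ cbfCone)
    (h0 : Tendsto g (𝓝[>] 0) (𝓝 (g 0))) : IsCompleteBernstein g := by
  obtain ⟨σ, hσ⟩ := hg
  set μ : Measure (Icc (0 : ℝ) 1) := FiniteMeasure.toMeasure σ with hμ
  set κ : Icc (0 : ℝ) 1 → ℝ≥0 := fun τ => Real.toNNReal (decayRate τ * (1 + decayRate τ)) with hκ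
  have hκv : ∀ τ, (κ τ : ℝ) = decayRate τ * (1 + decayRate τ) := fun τ =>
    Real.coe_toNNReal _ (mul_nonneg (decayRate_nonneg τ) (by linarith [decayRate_nonneg τ]))
  have hκm : Measurable κ :=
    (measurable_decayRate.mul (measurable_decayRate.const_add 1)).real_toNNReal
  set ρ : Measure (Icc (0 : ℝ) 1) := μ.withDensity fun τ => (κ τ : ENNReal) with hρ
  set m : ℝ → ℝ := fun s => mgf decayRate ρ (-s) with hm
  have hmv : ∀ s, m s = ∫ τ, decayRate τ * (1 + decayRate τ) * Real.exp (-s * decayRate τ) ∂μ := by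
    intro s
    simp only [hm, mgf, hρ]
    rw [integral_withDensity_eq_integral_smul hκm]
    simp only [NNReal.smul_def, hκv, smul_eq_mul]
  have hcm : IsCompletelyMonotone m := by
    refine isCompletelyMonotone_mgf_neg decayRate_nonneg fun s hs => ?_
    rw [hρ, integrable_withDensity_iff_integrable_smul hκm]
    have hs2 : 0 < s / 2 := half_pos hs
    -- Splitting `e^{-sr}` into two halves and using `r e^{-sr/2} ≤ 2/s` bounds `r (1 + r) e^{-sr}`
    -- by this constant.
    refine Integrable.mono' (integrable_const ((2 / s) * (1 + 2 / s)))
      (by have := measurable_decayRate; fun_prop) (ae_of_all _ fun τ => ?_)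
    simp only [NNReal.smul_def, hκv, smul_eq_mul]
    have hr := decayRate_nonneg τ
    set r := decayRate τ
    rw [Real.norm_of_nonneg (by positivity)]
    have hb : r * Real.exp (-(s / 2 * r)) ≤ 2 / s := by
      have h1 := mul_exp_neg_le (x := s / 2 * r)
      have h2 := Real.exp_pos (-(s / 2 * r))
      rw [le_div_iff₀ hs]
      linarith
    have hb1 : Real.exp (-(s / 2 * r)) ≤ 1 := Real.exp_le_one_iff.2 (by simp; positivity)
    calc r * (1 + r) * Real.exp (-s * r)
        = (r * Real.exp (-(s / 2 * r))) *
            (Real.exp (-(s / 2 * r)) + r * Real.exp (-(s / 2 * r))) := by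
          rw [show -s * r = -(s / 2 * r) + -(s / 2 * r) by ring, Real.exp_add]
          ring
      _ ≤ (2 / s) * (1 + 2 / s) := by gcongr
  have hfub : ∀ u, 0 < u → Integrable (Function.uncurry fun (τ : Icc (0 : ℝ) 1) (s : ℝ) =>
      decayRate τ * (1 + decayRate τ) * Real.exp (-s * decayRate τ) * (1 - Real.exp (-(u * s))))
      (μ.prod (volume.restrict (Ioi 0))) := by
    intro u hu
    have hmeas : Measurable (Function.uncurry fun (τ : Icc (0 : ℝ) 1) (s : ℝ) =>
      decayRate τ * (1 + decayRate τ) * Real.exp (-s * decayRate τ) *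
        (1 - Real.exp (-(u * s)))) := by
      have h1 : Measurable fun p : Icc (0 : ℝ) 1 × ℝ => decayRate p.1 :=
        measurable_decayRate.comp measurable_fst
      unfold Function.uncurry
      fun_prop
    rw [integrable_prod_iff hmeas.aestronglyMeasurable]
    refine ⟨ae_of_all _ fun τ => (levy_kernel_eq hu τ).1, ?_⟩
    have h2 : (fun τ : Icc (0 : ℝ) 1 => ∫ s in Ioi (0 : ℝ), ‖Function.uncurry
        (fun (τ : Icc (0 : ℝ) 1) (s : ℝ) => decayRate τ * (1 + decayRate τ) *
        Real.exp (-s * decayRate τ) * (1 - Real.exp (-(u * s)))) (τ, s)‖) = fun τ =>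
        cbfKernel u τ - indicator {0} (fun _ => (1 : ℝ)) τ - indicator {1} (fun _ => u) τ := by
      ext τ
      rw [← (levy_kernel_eq hu τ).2]
      refine setIntegral_congr_fun measurableSet_Ioi fun s hs => Real.norm_of_nonneg ?_
      have h3 := decayRate_nonneg τ
      exact mul_nonneg (by positivity) (one_sub_exp_neg_nonneg (mul_nonneg hu.le (le_of_lt hs)))
    rw [h2]
    exact ((integrable_cbfKernel hu μ).sub
      ((integrable_const 1).indicator (measurableSet_singleton 0))).sub
      ((integrable_const u).indicator (measurableSet_singleton 1))
  have hmint : ∀ u, (fun s => ∫ τ, decayRate τ * (1 + decayRate τ) * Real.exp (-s * decayRate τ) *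
      (1 - Real.exp (-(u * s))) ∂μ) = fun s => (1 - Real.exp (-(u * s))) * m s := by
    intro u
    ext s
    rw [integral_mul_const, hmv, mul_comm]
  refine isCompleteBernstein_of_levyKhintchine (m := m) (a := μ.real {0}) (b := μ.real {1})
    measureReal_nonneg measureReal_nonneg h0 hcm (fun u hu => ?_) fun u hu => ?_
  · rw [← hmint u]
    exact (hfub u hu).integral_prod_right
  · rw [← hmint u, ← integral_integral_swap (hfub u hu), hσ u hu]
    simp only [(levy_kernel_eq hu _).2]
    rw [integral_sub, integral_sub, integral_indicator (measurableSet_singleton 0),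
      integral_indicator (measurableSet_singleton 1)]
    · simp [Measure.real]
    · exact integrable_cbfKernel hu μ
    · exact (integrable_const 1).indicator (measurableSet_singleton 0)
    · exact (integrable_cbfKernel hu μ).sub
        ((integrable_const 1).indicator (measurableSet_singleton 0))
    · exact (integrable_const u).indicator (measurableSet_singleton 1)

/-! ### Cosine transforms of completely monotone functions -/

/-- The cosine transform of `φ`, as a function of the square of the frequency. -/
noncomputable def cosineTransform (φ : ℝ → ℝ) (u : ℝ) : ℝ :=
  ∫ r in Ioi (0 : ℝ), φ r * Real.cos (√u * r)

lemma tendsto_cosineTransform {ι : Type*} {l : Filter ι} [l.IsCountablyGenerated]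
    {φ : ι → ℝ → ℝ} {ψ B : ℝ → ℝ} (hB : IntegrableOn B (Ioi 0))
    (hm : ∀ i, AEStronglyMeasurable (φ i) (volume.restrict (Ioi 0)))
    (hφ : ∀ i r, 0 < r → |φ i r| ≤ B r)
    (h : ∀ r, 0 < r → Tendsto (fun i => φ i r) l (𝓝 (ψ r))) :
    Tendsto (fun i => cosineTransform (φ i)) l (𝓝 (cosineTransform ψ)) := by
  refine tendsto_pi_nhds.2 fun u => tendsto_integral_filter_of_dominated_convergence B
    (Eventually.of_forall fun i => (hm i).mul (Continuous.aestronglyMeasurable (by fun_prop)))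
    (Eventually.of_forall fun i => ?_) hB ?_
  · filter_upwards [self_mem_ae_restrict measurableSet_Ioi] with r hr
    rw [norm_mul, Real.norm_eq_abs, Real.norm_eq_abs]
    calc _ ≤ |φ i r| * 1 := mul_le_mul_of_nonneg_left (Real.abs_cos_le_one _) (abs_nonneg _)
      _ ≤ B r := by simpa using hφ i r hr
  · filter_upwards [self_mem_ae_restrict measurableSet_Ioi] with r hr
    exact (h r hr).mul_const _

lemma integrableOn_exp_neg_mul {s : ℝ} (hs : 0 < s) :
    IntegrableOn (fun r => Real.exp (-s * r)) (Ioi 0) :=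
  integrableOn_exp_mul_Ioi (by linarith) 0

lemma integral_exp_neg_mul_cos {s : ℝ} (hs : 0 < s) (x : ℝ) :
    ∫ r in Ioi (0 : ℝ), Real.exp (-s * r) * Real.cos (x * r) = s / (x ^ 2 + s ^ 2) := by
  have hre : ((-s : ℂ) + x * Complex.I).re < 0 := by simpa using hs
  have h1 := integral_exp_mul_complex_Ioi hre 0
  have h2 := integral_re (integrableOn_exp_mul_complex_Ioi hre 0)
  rw [h1] at h2
  have h3 : ∀ r : ℝ, RCLike.re (Complex.exp (((-s : ℂ) + x * Complex.I) * r)) =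
      Real.exp (-s * r) * Real.cos (x * r) := by
    intro r
    simp [Complex.exp_re]
  simp only [h3] at h2
  rw [h2]
  have h4 : x ^ 2 + s ^ 2 ≠ 0 := by positivity
  simp [Complex.div_re, Complex.normSq_apply]
  field_simp
  ring

lemma cosineTransform_exp_sum {ι : Type*} (t : Finset ι) (c s : ι → ℝ) (hs : ∀ j, 0 < s j) {u : ℝ}
    (hu : 0 ≤ u) :
    cosineTransform (fun r => ∑ j ∈ t, c j * Real.exp (-s j * r)) u =
      ∑ j ∈ t, c j * s j / (u + s j ^ 2) := by
  simp only [cosineTransform, Finset.sum_mul, mul_assoc]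
  rw [integral_finsetSum]
  · refine Finset.sum_congr rfl fun j _ => ?_
    rw [integral_const_mul, integral_exp_neg_mul_cos (hs j), Real.sq_sqrt hu, mul_div_assoc]
  · intro j _
    refine Integrable.const_mul ((integrableOn_exp_neg_mul (hs j)).mono'
      (Continuous.aestronglyMeasurable (by fun_prop)) (ae_of_all _ fun r => ?_)) _
    rw [norm_mul, Real.norm_of_nonneg (Real.exp_nonneg _)]
    exact mul_le_of_le_one_right (Real.exp_nonneg _) (Real.abs_cos_le_one _)

lemma cosineTransform_exp_sum_mem_of_pos {K : ℕ} {c s : Fin (K + 1) → ℝ} (hc : ∀ j, 0 < c j)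
    (hs : ∀ j, 0 < s j) (hmono : StrictMono s) :
    cosineTransform (fun r => ∑ j, c j * Real.exp (-s j * r)) ∈ finiteStieltjes :=
  ⟨K, fun j => s j ^ 2, fun j => c j * s j,
    fun i _ hij => pow_lt_pow_left₀ (hmono hij) (hs i).le two_ne_zero,
    fun j => pow_pos (hs j) 2, fun j => mul_pos (hc j) (hs j),
    fun _ hu => cosineTransform_exp_sum Finset.univ c s hs hu⟩

/-- `finiteStieltjes` demands positive coefficients, so vanishing ones are reached by adding `1 / (n
+ 1)` to all. -/
lemma cosineTransform_exp_sum_mem_closure {K : ℕ} {c s : Fin (K + 1) → ℝ} (hc : ∀ j, 0 ≤ c j)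
    (hs : ∀ j, 0 < s j) (hmono : StrictMono s) :
    cosineTransform (fun r => ∑ j, c j * Real.exp (-s j * r)) ∈ closure finiteStieltjes := by
  have hinv := tendsto_one_div_add_atTop_nhds_zero_nat (𝕜 := ℝ)
  refine mem_closure_of_tendsto (b := atTop)
    (f := fun n : ℕ => cosineTransform
      (fun r => ∑ j, (c j + 1 / ((n : ℝ) + 1)) * Real.exp (-s j * r)))
    (tendsto_cosineTransform (B := fun r => ∑ j, (c j + 1) * Real.exp (-s j * r)) ?_
      (fun n => Continuous.aestronglyMeasurable (by fun_prop)) ?_ ?_) ?_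
  · exact integrable_finsetSum _ fun j _ => (integrableOn_exp_neg_mul (hs j)).const_mul _
  · intro n r _
    have h1 : ∀ j, 0 ≤ c j + 1 / ((n : ℝ) + 1) := fun j => add_nonneg (hc j) (by positivity)
    rw [abs_of_nonneg (Finset.sum_nonneg fun j _ => mul_nonneg (h1 j) (Real.exp_nonneg _))]
    gcongr with j
    rw [div_le_one (by positivity)]
    linarith [(Nat.cast_nonneg n : (0 : ℝ) ≤ n)]
  · intro r _
    refine tendsto_finsetSum _ fun j _ => Tendsto.mul_const _ ?_
    simpa using hinv.const_add (c j)
  · exact Eventually.of_forall fun n => cosineTransform_exp_sum_mem_of_pos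
      (fun j => add_pos_of_nonneg_of_pos (hc j) (by positivity)) hs hmono

namespace AltDerivSeq

variable {G : ℕ → ℝ → ℝ}

lemma continuousOn (hG : AltDerivSeq G) : ContinuousOn (G 0) (Ioi 0) :=
  fun x hx => (hG.hasDerivAt 0 x hx).continuousAt.continuousWithinAt

lemma rescaled_mem_Ioo {n r : ℝ} (hn : 0 < n) (hr : 0 < r) :
    n * (1 - Real.exp (-(r / n))) ∈ Ioo 0 n := by
  have h1 : Real.exp (-(r / n)) < 1 := Real.exp_lt_one_iff.2 (neg_lt_zero.2 (by positivity))
  have h2 := Real.exp_pos (-(r / n))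
  constructor <;> nlinarith

/-- At `x = n (1 - e^{-r/n})` one has `n - x = n e^{-r/n}`, so Taylor powers become exponentials.
The factor `e^{-εr}` makes the `k = 0` rate positive too. -/
lemma hasSum_exp (hG : AltDerivSeq G) {n : ℝ} (hn : 0 < n) {r : ℝ} (hr : 0 < r) (ε : ℝ) :
    HasSum (fun k : ℕ => G k n / (k.factorial : ℝ) * n ^ k * Real.exp (-(k / n + ε) * r))
      (G 0 (n * (1 - Real.exp (-(r / n)))) * Real.exp (-ε * r)) := by
  have h := rescaled_mem_Ioo hn hr
  refine ((hG.hasSum_taylor h.1 h.2).mul_right (Real.exp (-ε * r))).congr_fun fun k => ?_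
  rw [show n - n * (1 - Real.exp (-(r / n))) = n * Real.exp (-(r / n)) by ring, mul_pow,
    ← Real.exp_nat_mul, show -(k / n + ε) * r = k * -(r / n) + -ε * r by field_simp; ring,
    Real.exp_add]
  ring

lemma tendsto_rescaled (r : ℝ) :
    Tendsto (fun n : ℕ => ((n : ℝ) + 1) * (1 - Real.exp (-(r / ((n : ℝ) + 1))))) atTop (𝓝 r) := by
  -- With `y = 1 / (n + 1)` the sequence is a difference quotient of this function at `0`.
  have h1 : HasDerivAt (fun y : ℝ => -Real.exp (-(r * y))) r 0 := by
    have h2 : HasDerivAt (fun y : ℝ => -(r * y)) (-r) 0 := by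
      simpa using ((hasDerivAt_id (0 : ℝ)).const_mul r).fun_neg
    simpa using h2.exp.fun_neg
  have h3 : Tendsto (fun n : ℕ => 1 / ((n : ℝ) + 1)) atTop (𝓝[>] 0) :=
    tendsto_nhdsWithin_iff.2 ⟨tendsto_one_div_add_atTop_nhds_zero_nat,
      Eventually.of_forall fun n => by simp only [mem_Ioi]; positivity⟩
  refine (h1.tendsto_slope_zero_right.comp h3).congr fun n => ?_
  simp [div_eq_mul_inv]
  left
  ring

/-- The cosine transform of an integrable completely monotone function bounded by `1` is a limit
of finite Stieltjes sums. -/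
lemma cosineTransform_mem_closure (hG : AltDerivSeq G) (h1 : ∀ r, 0 < r → G 0 r ≤ 1)
    (hint : IntegrableOn (G 0) (Ioi 0)) :
    cosineTransform (G 0) ∈ closure finiteStieltjes := by
  have hres : ∀ n : ℝ, 0 < n → AEStronglyMeasurable
      (fun r => G 0 (n * (1 - Real.exp (-(r / n))))) (volume.restrict (Ioi 0)) := fun n hn =>
    (hG.continuousOn.comp (Continuous.continuousOn (by fun_prop))
      fun r hr => (rescaled_mem_Ioo hn hr).1).aestronglyMeasurable measurableSet_Ioi
  -- The limits are taken in the order `K → ∞`, `n → ∞`, `ε → 0`. The first two are dominated by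
  -- `e^{-εr}`, as `G 0 ≤ 1`; the last by `G 0`.
  have step1 : ∀ n : ℝ, 0 < n → ∀ ε : ℝ, 0 < ε → cosineTransform (fun r =>
      G 0 (n * (1 - Real.exp (-(r / n)))) * Real.exp (-ε * r)) ∈ closure finiteStieltjes := by
    intro n hn ε hε
    have hc : ∀ k : ℕ, 0 ≤ G k n / (k.factorial : ℝ) * n ^ k := fun k =>
      mul_nonneg (div_nonneg (hG.nonneg k n hn) (by positivity)) (by positivity)
    refine isClosed_closure.mem_of_tendsto (b := atTop) (f := fun K : ℕ => cosineTransform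
      (fun r => ∑ k ∈ Finset.range (K + 1),
        G k n / (k.factorial : ℝ) * n ^ k * Real.exp (-(k / n + ε) * r)))
      (tendsto_cosineTransform (integrableOn_exp_neg_mul hε)
        (fun K => Continuous.aestronglyMeasurable (by fun_prop)) ?_ ?_)
      (Eventually.of_forall fun K => ?_)
    · intro K r hr
      rw [abs_of_nonneg (Finset.sum_nonneg fun k _ => mul_nonneg (hc k) (Real.exp_nonneg _))]
      refine (sum_le_hasSum _ (fun k _ => mul_nonneg (hc k) (Real.exp_nonneg _))
        (hG.hasSum_exp hn hr ε)).trans ?_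
      exact mul_le_of_le_one_left (Real.exp_nonneg _) (h1 _ (rescaled_mem_Ioo hn hr).1)
    · intro r hr
      exact (hG.hasSum_exp hn hr ε).tendsto_sum_nat.comp (tendsto_add_atTop_nat 1)
    · have := cosineTransform_exp_sum_mem_closure (K := K)
        (c := fun j => G j n / ((j : ℕ).factorial : ℝ) * n ^ (j : ℕ))
        (s := fun j => (j : ℕ) / n + ε) (fun j => hc j) (fun j => by positivity)
        (fun i j hij => by
          have : ((i : ℕ) : ℝ) < (j : ℕ) := by exact_mod_cast hij
          simp only
          gcongr)
      convert this using 3 with r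
      rw [Finset.sum_range]
  have step2 : ∀ ε : ℝ, 0 < ε → cosineTransform (fun r => G 0 r * Real.exp (-ε * r)) ∈
      closure finiteStieltjes := by
    intro ε hε
    refine isClosed_closure.mem_of_tendsto (b := atTop) (f := fun n : ℕ => cosineTransform
      (fun r => G 0 (((n : ℝ) + 1) * (1 - Real.exp (-(r / ((n : ℝ) + 1))))) * Real.exp (-ε * r)))
      (tendsto_cosineTransform (integrableOn_exp_neg_mul hε) (fun n => ?_) ?_ ?_)
      (Eventually.of_forall fun n => step1 _ (by positivity) ε hε)
    · exact (hres _ (by positivity)).mul (Continuous.aestronglyMeasurable (by fun_prop))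
    · intro n r hr
      have h := (rescaled_mem_Ioo (n := (n : ℝ) + 1) (by positivity) hr).1
      rw [abs_of_nonneg (mul_nonneg (hG.nonneg 0 _ h) (Real.exp_nonneg _))]
      exact mul_le_of_le_one_left (Real.exp_nonneg _) (h1 _ h)
    · intro r hr
      exact ((hG.hasDerivAt 0 r hr).continuousAt.tendsto.comp (tendsto_rescaled r)).mul_const _
  refine isClosed_closure.mem_of_tendsto (b := atTop) (f := fun n : ℕ => cosineTransform
    (fun r => G 0 r * Real.exp (-(1 / ((n : ℝ) + 1)) * r)))
    (tendsto_cosineTransform hint (fun n => ?_) ?_ ?_)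
    (Eventually.of_forall fun n => step2 _ (by positivity))
  · exact hint.aestronglyMeasurable.mul (Continuous.aestronglyMeasurable (by fun_prop))
  · intro n r hr
    rw [abs_of_nonneg (mul_nonneg (hG.nonneg 0 r hr) (Real.exp_nonneg _))]
    refine mul_le_of_le_one_right (hG.nonneg 0 r hr) (Real.exp_le_one_iff.2 ?_)
    rw [neg_mul, neg_nonpos]
    positivity
  · intro r _
    have h2 := ((tendsto_one_div_add_atTop_nhds_zero_nat (𝕜 := ℝ)).neg.mul_const r).rexp
    simpa using h2.const_mul (G 0 r)

end AltDerivSeq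

/-! ### Fourier inversion and conclusion -/

lemma setIntegral_Ioi_pos {φ : ℝ → ℝ} (hφ : IntegrableOn φ (Ioi 0)) (h : ∀ r, 0 < φ r) :
    0 < ∫ r in Ioi (0 : ℝ), φ r := by
  rw [setIntegral_pos_iff_support_of_nonneg_ae (ae_of_all _ fun r => (h r).le) hφ,
    Function.support_eq_univ fun r => (h r).ne', univ_inter]
  simp

open scoped FourierTransform in
/-- Inversion formula for a continuous density whose characteristic function is an integrable
positive even function. -/
lemma eq_cosine_integral_of_charFun {p φ : ℝ → ℝ} {μ : Measure ℝ} [IsProbabilityMeasure μ]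
    (hp : Continuous p) (hp0 : ∀ x, 0 ≤ p x)
    (hμ : μ = volume.withDensity fun x => ENNReal.ofReal (p x))
    (hφ0 : ∀ r, 0 < φ r) (hφ : IntegrableOn φ (Ioi 0))
    (hchar : ∀ ξ : ℝ, charFun μ ξ = (φ |ξ| : ℂ)) (x : ℝ) :
    p x = Real.pi⁻¹ * ∫ r in Ioi (0 : ℝ), φ r * Real.cos (x * r) := by
  have hpi := Real.pi_pos
  have hpint : Integrable p := by
    refine ⟨hp.aestronglyMeasurable, ?_⟩
    rw [hasFiniteIntegral_iff_ofReal (ae_of_all _ hp0)]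
    have h1 : μ univ = 1 := measure_univ
    rw [hμ, withDensity_apply _ MeasurableSet.univ, Measure.restrict_univ] at h1
    rw [h1]
    exact ENNReal.one_lt_top
  have hF : 𝓕 (fun x => (p x : ℂ)) = fun w => ((φ (2 * Real.pi * |w|) : ℝ) : ℂ) := by
    ext w
    -- The Fourier kernel is `e^{-2πivw}`, so the characteristic function is taken at `-2πw`.
    have h1 := hchar (-(2 * Real.pi * w))
    rw [abs_neg, abs_mul, abs_of_pos (by positivity : 0 < 2 * Real.pi)] at h1
    rw [← h1, charFun_apply_real, hμ]
    simp only [ENNReal.ofReal]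
    rw [integral_withDensity_eq_integral_smul hp.measurable.real_toNNReal, Real.fourier_eq']
    refine integral_congr_ae (ae_of_all _ fun v => ?_)
    simp only [NNReal.smul_def, Real.coe_toNNReal _ (hp0 v), RCLike.inner_apply, conj_trivial,
      smul_eq_mul, Complex.real_smul]
    rw [mul_comm]
    congr 2
    push_cast
    ring
  have hsc : IntegrableOn (fun r => φ (2 * Real.pi * r)) (Ioi 0) := by
    rw [integrableOn_Ioi_comp_mul_left_iff φ 0 (by positivity : 0 < 2 * Real.pi), mul_zero]
    exact hφ
  have hFint : Integrable fun w : ℝ => φ (2 * Real.pi * |w|) := by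
    -- A non-integrable function has integral `0` by convention, so a positive integral suffices.
    refine Integrable.of_integral_ne_zero ?_
    rw [integral_comp_abs (f := fun w => φ (2 * Real.pi * w))]
    exact (mul_pos two_pos (setIntegral_Ioi_pos hsc fun r => hφ0 _)).ne'
  have hinv := congrFun (Continuous.fourierInv_fourier_eq (f := fun x => (p x : ℂ))
    (by fun_prop) hpint.ofReal (by rw [hF]; exact hFint.ofReal)) x
  rw [hF, Real.fourierInv_eq'] at hinv
  have hint : Integrable fun v : ℝ => Complex.exp ((↑(2 * Real.pi * inner ℝ v x) * Complex.I)) •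
      ((φ (2 * Real.pi * |v|) : ℝ) : ℂ) := by
    refine hFint.ofReal.bdd_mul (c := 1) (Continuous.aestronglyMeasurable (by fun_prop))
      (ae_of_all _ fun v => ?_)
    rw [Complex.norm_exp_ofReal_mul_I]
  have hre := congrArg Complex.re hinv
  have h2 := integral_re hint
  simp only [RCLike.re_to_complex] at h2
  rw [← h2, Complex.ofReal_re] at hre
  have h3 : ∀ v : ℝ, (Complex.exp ((↑(2 * Real.pi * inner ℝ v x) * Complex.I)) •
      ((φ (2 * Real.pi * |v|) : ℝ) : ℂ)).re =
      (fun r => φ (2 * Real.pi * r) * Real.cos (x * (2 * Real.pi * r))) |v| := by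
    intro v
    rw [smul_eq_mul, Complex.re_mul_ofReal, Complex.exp_ofReal_mul_I_re]
    simp only [RCLike.inner_apply, conj_trivial]
    rw [mul_comm]
    congr 1
    rcases abs_choice v with h | h <;> rw [h]
    · congr 1; ring
    · rw [← Real.cos_neg]; congr 1; ring
  simp only [h3] at hre
  rw [integral_comp_abs (f := fun r => φ (2 * Real.pi * r) * Real.cos (x * (2 * Real.pi * r))),
    integral_comp_mul_left_Ioi (fun r => φ r * Real.cos (x * r)) 0 (by positivity), mul_zero,
    smul_eq_mul] at hre
  rw [← hre]
  field_simp

/-- A continuous function which is the cosine integral of a completely monotone function equals, up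
to normalisation, `e^{-g(x²)}` with `g` complete Bernstein. -/
lemma exists_isCompleteBernstein_of_cosine_integral {p : ℝ → ℝ} (hp : Continuous p)
    {G : ℕ → ℝ → ℝ} (hG : AltDerivSeq G) (h1 : ∀ r, 0 < r → G 0 r ≤ 1) (h0 : ∀ r, 0 < G 0 r)
    (hint : IntegrableOn (G 0) (Ioi 0))
    (hpG : ∀ x, p x = Real.pi⁻¹ * ∫ r in Ioi (0 : ℝ), G 0 r * Real.cos (x * r)) :
    ∃ g : ℝ → ℝ, IsCompleteBernstein g ∧ ∀ x : ℝ, p x / p 0 = Real.exp (-g (|x| ^ 2)) := by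
  set h := cosineTransform (G 0) with hh
  have hmem : h ∈ closure finiteStieltjes := hG.cosineTransform_mem_closure h1 hint
  have hhp : ∀ u, h u = Real.pi * p √u := by
    intro u
    rw [hpG, ← mul_assoc, mul_inv_cancel₀ Real.pi_ne_zero, one_mul]
    rfl
  -- `√` is continuous on all of `ℝ`, vanishing on negatives, so continuity of `p` passes to `h`,
  -- including at `0`.
  have hcont : Continuous h := by
    rw [funext hhp]
    fun_prop
  have hpos0 : 0 < h 0 := by
    rw [hhp, hpG, ← mul_assoc, mul_inv_cancel₀ Real.pi_ne_zero, one_mul]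
    simpa using setIntegral_Ioi_pos hint h0
  have hpos : ∀ u, 0 ≤ u → 0 < h u := fun u hu =>
    pos_of_mem_closure hmem hpos0 hcont.continuousWithinAt hu
  refine ⟨fun u => -Real.log (h u / h 0), isCompleteBernstein_of_mem_cbfCone
    (neg_log_div_mem_cbfCone hmem hpos0 hcont.continuousWithinAt) ?_, fun x => ?_⟩
  · have h2 : ContinuousAt (fun u => -Real.log (h u / h 0)) 0 :=
      ((hcont.continuousAt.div_const _).log (div_pos hpos0 hpos0).ne').neg
    exact h2.tendsto.mono_left nhdsWithin_le_nhds
  · have heven : p |x| = p x := by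
      rcases abs_choice x with h | h
      · rw [h]
      · rw [h, hpG, hpG x]
        simp
    rw [neg_neg, Real.exp_log (div_pos (hpos _ (by positivity)) hpos0), hhp, hhp,
      Real.sqrt_sq (abs_nonneg x), Real.sqrt_zero, heven,
      mul_div_mul_left _ _ Real.pi_ne_zero]

theorem theorem7p1 {Ω : Type*} [MeasurableSpace Ω] (P : Measure Ω) [IsProbabilityMeasure P]
    (X : ℝ≥0 → Ω → ℝ) (hX : IsLevyProcess X P)
    (f : ℝ → ℝ) (hf : IsBernstein f) (hf0 : f 0 = 0)
    (hchar : ∀ t : ℝ≥0, 0 < t → ∀ ξ : ℝ,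
      charFun (P.map (X t)) ξ = (Real.exp (-((t : ℝ) * f |ξ|)) : ℂ))
    (hint : ∀ t : ℝ≥0, 0 < t →
      IntegrableOn (fun r : ℝ => Real.exp (-((t : ℝ) * f r))) (Ioi 0))
    (p : ℝ≥0 → ℝ → ℝ) (hp : IsTransitionDensity X P p) :
    ∀ t : ℝ≥0, 0 < t → ∃ g : ℝ → ℝ, IsCompleteBernstein g ∧
      ∀ x : ℝ, p t x / p t 0 = Real.exp (-g (|x| ^ 2)) := by
  intro t ht
  have hprob : IsProbabilityMeasure (P.map (X t)) :=
    Measure.isProbabilityMeasure_map (hX.measurable t).aemeasurable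
  refine exists_isCompleteBernstein_of_cosine_integral (hp.continuous t ht)
    (hf.altDerivSeq_exp t.coe_nonneg) ?_ ?_ ?_ ?_ <;>
    simp only [pow_zero, one_mul, iteratedDeriv_zero]
  · intro r hr
    rw [Real.exp_le_one_iff, neg_nonpos]
    exact mul_nonneg t.coe_nonneg (hf.nonneg r hr)
  · intro r
    exact Real.exp_pos _
  · exact hint t ht
  · exact eq_cosine_integral_of_charFun (hp.continuous t ht) (hp.nonneg t ht) (hp.map_eq t ht)
      (fun r => Real.exp_pos _) (hint t ht) fun ξ => by
        rw [hchar t ht]
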